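/- Let $K$ be a field, let $\mathcal D$ be a small $K$-linear category and let $(C,\Delta,\varepsilon)$ be a (coassociative, counital) $K$-coalgebra, with $\Delta(c)=c_1\otimes c_2$ (summation omitted). A right-right entwining structure $(\mathcal D,C,\psi)$ is a family of $K$-linear maps $\psi_{XY}:C\otimes \mathrm{Hom}_{\mathcal D}(X,Y)\to \mathrm{Hom}_{\mathcal D}(X,Y)\otimes C$, written $\psi_{XY}(c\otimes f)=f_\psi\otimes c^\psi$, such that, for $f:X\to Y$, $g:Y\to Z$ and $c\in C$, $$(gf)_\psi\otimes c^\psi=g_\psi f_\psi\otimes {c^\psi}^\psi,\quad \varepsilon(c^\psi)f_\psi=\varepsilon(c)f,\quad f_\psi\otimes\Delta(c^\psi)={f_\psi}_\psi\otimes {c_1}^\psi\otimes {c_2}^\psi,\quad \psi_{XX}(c\otimes \mathrm{id}_X)=\mathrm{id}_X\otimes c,$$ where in the first identity $\psi$ is applied first with $g$ and then with $f$, and in the third first with $c_2$ and then with $c_1$. A right $\mathcal D$-module is a $K$-linear functor $\mathcal D^{op}\to \mathrm{Vect}_K$; these form the category $\mathrm{Mod}\text{-}\mathcal D$. An entwined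 module is a right $\mathcal D$-module $\mathcal M$ with a right $C$-comodule structure $\rho$, $\rho(m)=m_0\otimes m_1$, on each $\mathcal M(X)$ such that $\rho(\mathcal M(f)(m))=\mathcal M(f_\psi)(m_0)\otimes {m_1}^\psi$ for all $f:Y\to X$ and $m\in\mathcal M(X)$. The morphisms of entwined modules are the morphisms of $\mathcal D$-modules with $C$-colinear components. Let $\mathscr F$ be the functor from entwined modules to $\mathrm{Mod}\text{-}\mathcal D$ forgetting the coaction, and let $\mathscr G=-\otimes C$ be its right adjoint: $(\mathcal N\otimes C)(X)=\mathcal N(X)\otimes C$, $(\mathcal N\otimes C)(f)(n\otimes c)=\mathcal N(f_\psi)(n)\otimes c^\psi$, with coaction $n\otimes c\mapsto n\otimes c_1\otimes c_2$. The pair $(\mathscr F,\mathscr G)$ is called a Frobenius pair if $\mathscr G$ is both a right and a left adjoint of $\mathscr F$. Let $V_1$ be the space of families $\theta=\{\theta_X:C\otimes C\to \mathrm{End}_{\mathcal D}(X)\}_{X}$ of $K$-linear maps such that, for all $f:Y\to X$ and $c,d\in C$, $$\theta_X(c\otimes d)\circ f={f_\psi}_\psi\circ\theta_Y(c^\psi\otimes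 d^\psi),\qquad \theta_X(c\otimes d_1)\otimes d_2=(\theta_X(c_2\otimes d))_\psi\otimes {c_1}^\psi,$$ where in the first identity $\psi$ is applied first with $d$ and then with $c$. Let $h$ and $h\otimes C$ be the $\mathcal D$-$\mathcal D$-bimodules ($K$-linear functors $\mathcal D^{op}\otimes\mathcal D\to\mathrm{Vect}_K$) given by $h(X,Y)=\mathrm{Hom}_{\mathcal D}(X,Y)$, $h(\phi',\phi'')(f)=\phi'' f\phi'$, and $(h\otimes C)(X,Y)=\mathrm{Hom}_{\mathcal D}(X,Y)\otimes C$, $(h\otimes C)(\phi',\phi'')(f\otimes c)=\phi'' f\phi'_\psi\otimes c^\psi$. Let $W_1=\mathrm{Nat}(h,h\otimes C)$. Theorem. $(\mathscr F,\mathscr G)$ is a Frobenius pair if and only if there exist $\theta\in V_1$ and $\eta\in W_1$ such that, for all objects $X,Y$, all $f\in\mathrm{Hom}_{\mathcal D}(X,Y)$ and all $d\in C$, writing $\eta(X,Y)(f)=\sum\hat f\otimes c_f$, $$\varepsilon(d)f=\sum\hat f\circ\theta_X(c_f\otimes d)\qquad\text{and}\qquad \varepsilon(d)f=\sum\hat f_\psi\circ\theta_X(d^\psi\otimes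 c_f).$$ -/

import Mathlib

open CategoryTheory TensorProduct Opposite

universe u v

namespace Entwined

section TwistedAction

variable {K : Type*} [Field K] {C H P Q : Type*}
  [AddCommGroup C] [Module K C] [AddCommGroup H] [Module K H]
  [AddCommGroup P] [Module K P] [AddCommGroup Q] [Module K Q]

/-- For `ψ : C ⊗ H → H ⊗ C`, written `ψ (c ⊗ f) = f_ψ ⊗ c^ψ`, and a bilinear map `A : P × H → Q`,
the linear map `P ⊗ C → Q ⊗ C`, `p ⊗ c ↦ A (p, f_ψ) ⊗ c^ψ`. -/
def twistedAction (ψ : C ⊗[K] H →ₗ[K] H ⊗[K] C) (A : P →ₗ[K] H →ₗ[K] Q) (f : H) :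
    P ⊗[K] C →ₗ[K] Q ⊗[K] C :=
  TensorProduct.lift (LinearMap.mk₂ K (fun p c => (A p).rTensor C (ψ (c ⊗ₜ[K] f)))
    (by intro p p' c; simp [LinearMap.rTensor_add])
    (by intro r p c; simp [LinearMap.rTensor_smul])
    (by intro p c c'; simp [TensorProduct.add_tmul])
    (by intro r p c; simp [← TensorProduct.smul_tmul']))

@[simp]
theorem twistedAction_tmul (ψ : C ⊗[K] H →ₗ[K] H ⊗[K] C) (A : P →ₗ[K] H →ₗ[K] Q) (f : H)
    (p : P) (c : C) :
    twistedAction ψ A f (p ⊗ₜ[K] c) = (A p).rTensor C (ψ (c ⊗ₜ[K] f)) := rfl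

theorem twistedAction_add (ψ : C ⊗[K] H →ₗ[K] H ⊗[K] C) (A : P →ₗ[K] H →ₗ[K] Q) (f g : H) :
    twistedAction ψ A (f + g) = twistedAction ψ A f + twistedAction ψ A g := by
  ext p c; simp [TensorProduct.tmul_add]

theorem twistedAction_smul (ψ : C ⊗[K] H →ₗ[K] H ⊗[K] C) (A : P →ₗ[K] H →ₗ[K] Q) (r : K) (f : H) :
    twistedAction ψ A (r • f) = r • twistedAction ψ A f := by
  ext p c; simp

/-- A right coaction of the coalgebra `C` on `P`: a coassociative and counital linear map
`ρ : P → P ⊗ C`, so that `(P, ρ)` is a right `C`-comodule. -/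
structure IsRightCoaction [Coalgebra K C] (ρ : P →ₗ[K] P ⊗[K] C) : Prop where
  coassoc : ∀ p, TensorProduct.assoc K P C C (ρ.rTensor C (ρ p)) =
    (Coalgebra.comul (R := K) (A := C)).lTensor P (ρ p)
  counit : ∀ p, TensorProduct.rid K P ((Coalgebra.counit (R := K) (A := C)).lTensor P (ρ p)) = p

end TwistedAction

section Category

variable (K : Type u) [Field K] (D : Type v) [Category.{u} D] [Preadditive D] [Linear K D]

/-- `K`-linear functors `Dᵒᵖ ⥤ Vect_K`. -/
def isRightModule : ObjectProperty (Dᵒᵖ ⥤ ModuleCat.{u} K) := fun M =>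
  (∀ (Y X : D) (f g : Y ⟶ X), M.map (f + g).op = M.map f.op + M.map g.op) ∧
  (∀ (Y X : D) (r : K) (f : Y ⟶ X), M.map (r • f).op = r • M.map f.op)

/-- The category `Mod-D` of right modules over the `K`-linear category `D`: `K`-linear functors
`Dᵒᵖ ⥤ Vect_K` and natural transformations. -/
abbrev RightModule := (isRightModule K D).FullSubcategory

variable {K D}

namespace RightModule

/-- The vector space `M(X)`. -/
abbrev fiber (M : RightModule K D) (X : D) : Type u := M.obj.obj (op X)

/-- The component at `X` of a morphism of right modules. -/
abbrev component {M N : RightModule K D} (φ : M ⟶ N) (X : D) : M.fiber X →ₗ[K] N.fiber X :=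
  (φ.hom.app (op X)).hom

/-- The action `(m, f) ↦ M(f)(m)` as a bilinear map `M(X) × Hom(Y, X) → M(Y)`. -/
def act (M : RightModule K D) (Y X : D) : M.fiber X →ₗ[K] (Y ⟶ X) →ₗ[K] M.fiber Y :=
  LinearMap.mk₂ K (fun m f => (M.obj.map f.op).hom m)
    (by intros; simp)
    (by intros; simp)
    (by intro m f g; rw [M.property.1]; simp)
    (by intro r m f; rw [M.property.2]; simp)

@[simp]
theorem act_apply (M : RightModule K D) {Y X : D} (m : M.fiber X) (f : Y ⟶ X) :
    M.act Y X m f = (M.obj.map f.op).hom m := rfl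

end RightModule

variable (K D)

/-- Composition `(g, f) ↦ g ∘ f` as a bilinear map `Hom(Y, Z) × Hom(X, Y) → Hom(X, Z)`. -/
def homComp (X Y Z : D) : (Y ⟶ Z) →ₗ[K] (X ⟶ Y) →ₗ[K] (X ⟶ Z) := (Linear.comp X Y Z).flip

@[simp]
theorem homComp_apply (X Y Z : D) (g : Y ⟶ Z) (f : X ⟶ Y) : homComp K D X Y Z g f = f ≫ g := rfl

section Evaluation

variable {K D} {C : Type u} [AddCommGroup C] [Module K C]

/-- For `t : C ⊗ C → End(X)` and `d : C`, the linear map `Hom(X, Y) ⊗ C → Hom(X, Y)`,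
`g ⊗ c ↦ g ∘ t(c ⊗ d)`. -/
def evalRight {X : D} (t : C ⊗[K] C →ₗ[K] (X ⟶ X)) (Y : D) (d : C) :
    (X ⟶ Y) ⊗[K] C →ₗ[K] (X ⟶ Y) :=
  TensorProduct.lift (LinearMap.mk₂ K (fun g c => t (c ⊗ₜ[K] d) ≫ g)
    (by intros; simp)
    (by intros; simp)
    (by intros; simp [TensorProduct.add_tmul])
    (by intros; simp [← TensorProduct.smul_tmul']))

@[simp]
theorem evalRight_tmul {X : D} (t : C ⊗[K] C →ₗ[K] (X ⟶ X)) (Y : D) (d : C) (g : X ⟶ Y) (c : C) :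
    evalRight t Y d (g ⊗ₜ[K] c) = t (c ⊗ₜ[K] d) ≫ g := rfl

theorem evalRight_add {X : D} (t : C ⊗[K] C →ₗ[K] (X ⟶ X)) (Y : D) (d d' : C) :
    evalRight t Y (d + d') = evalRight t Y d + evalRight t Y d' := by
  ext g c; simp [TensorProduct.tmul_add]

theorem evalRight_smul {X : D} (t : C ⊗[K] C →ₗ[K] (X ⟶ X)) (Y : D) (r : K) (d : C) :
    evalRight t Y (r • d) = r • evalRight t Y d := by
  ext g c; simp

end Evaluation

/-- A right-right entwining structure `(D, C, ψ)`, with `ψ_{XY} (c ⊗ f) = f_ψ ⊗ c^ψ`. -/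
structure Entwining (C : Type u) [AddCommGroup C] [Module K C] [Coalgebra K C] where
  /-- the linear maps `ψ_{XY} : C ⊗ Hom(X, Y) → Hom(X, Y) ⊗ C` -/
  ψ : ∀ X Y : D, C ⊗[K] (X ⟶ Y) →ₗ[K] (X ⟶ Y) ⊗[K] C
  /-- `(g f)_ψ ⊗ c^ψ = g_ψ f_ψ ⊗ (c^ψ)^ψ` -/
  ψ_comp : ∀ (X Y Z : D) (f : X ⟶ Y) (g : Y ⟶ Z) (c : C),
    ψ X Z (c ⊗ₜ[K] (f ≫ g)) = twistedAction (ψ X Y) (homComp K D X Y Z) f (ψ Y Z (c ⊗ₜ[K] g))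
  /-- `ε(c^ψ) f_ψ = ε(c) f` -/
  ψ_counit : ∀ (X Y : D) (f : X ⟶ Y) (c : C),
    TensorProduct.rid K (X ⟶ Y)
      ((Coalgebra.counit (R := K) (A := C)).lTensor (X ⟶ Y) (ψ X Y (c ⊗ₜ[K] f))) =
      Coalgebra.counit (R := K) c • f
  /-- `f_ψ ⊗ Δ(c^ψ) = (f_ψ)_ψ ⊗ (c₁)^ψ ⊗ (c₂)^ψ`, where `ψ` is applied first with `c₂` and then
  with `c₁` -/
  ψ_comul : ∀ (X Y : D) (f : X ⟶ Y) (c : C),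
    (Coalgebra.comul (R := K) (A := C)).lTensor (X ⟶ Y) (ψ X Y (c ⊗ₜ[K] f)) =
      TensorProduct.assoc K (X ⟶ Y) C C ((ψ X Y).rTensor C
        ((TensorProduct.assoc K C (X ⟶ Y) C).symm ((ψ X Y).lTensor C
          (TensorProduct.assoc K C C (X ⟶ Y) (Coalgebra.comul (R := K) c ⊗ₜ[K] f)))))
  /-- `ψ_{XX} (c ⊗ id_X) = id_X ⊗ c` -/
  ψ_id : ∀ (X : D) (c : C), ψ X X (c ⊗ₜ[K] 𝟙 X) = 𝟙 X ⊗ₜ[K] c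

variable {K D} {C : Type u} [AddCommGroup C] [Module K C] [Coalgebra K C]

/-- An entwined module over `(D, C, ψ)`: a right `D`-module `M` with a right `C`-comodule structure
on each `M(X)` such that `ρ (M(f)(m)) = M(f_ψ)(m₀) ⊗ m₁^ψ`. -/
structure EntwinedModule (E : Entwining K D C) where
  /-- the underlying right module -/
  toModule : RightModule K D
  /-- the coactions -/
  ρ : ∀ X : D, toModule.fiber X →ₗ[K] toModule.fiber X ⊗[K] C
  isRightCoaction : ∀ X : D, IsRightCoaction (ρ X)
  compat : ∀ (Y X : D) (f : Y ⟶ X) (m : toModule.fiber X),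
    ρ Y ((toModule.obj.map f.op).hom m) = twistedAction (E.ψ Y X) (toModule.act Y X) f (ρ X m)

namespace EntwinedModule

variable {E : Entwining K D C}

/-- Morphisms of entwined modules: morphisms of right modules with `C`-colinear components. -/
@[ext]
structure Hom (M N : EntwinedModule E) where
  /-- the underlying morphism of right modules -/
  hom : M.toModule ⟶ N.toModule
  colinear : ∀ (X : D) (m : M.toModule.fiber X),
    N.ρ X (RightModule.component hom X m) = (RightModule.component hom X).rTensor C (M.ρ X m)

/-- The category of entwined modules. -/
instance : Category (EntwinedModule E) where
  Hom M N := Hom M N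
  id M := ⟨𝟙 _, by intro X m; simp [RightModule.component]⟩
  comp φ χ := ⟨φ.hom ≫ χ.hom, by
    intro X m
    have h1 := φ.colinear X m
    have h2 := χ.colinear X (RightModule.component φ.hom X m)
    simp only [RightModule.component] at h1 h2 ⊢
    simp [h2, h1, LinearMap.rTensor_comp_apply]⟩

end EntwinedModule

/-- The functor `𝓕` forgetting the `C`-coactions. -/
abbrev forgetful (E : Entwining K D C) : EntwinedModule E ⥤ RightModule K D where
  obj M := M.toModule
  map φ := φ.hom

section CofreeModule

variable (E : Entwining K D C) (M : RightModule K D)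

theorem twistedAction_id {P : Type u} [AddCommGroup P] [Module K P] (X : D)
    (A : P →ₗ[K] (X ⟶ X) →ₗ[K] P) (hA : ∀ p, A p (𝟙 X) = p) (t : P ⊗[K] C) :
    twistedAction (E.ψ X X) A (𝟙 X) t = t := by
  induction t with
  | zero => simp
  | add s t hs ht => rw [map_add, hs, ht]
  | tmul m c => simp [E.ψ_id, hA]

theorem twistedAction_comp {P Q R : Type u} [AddCommGroup P] [Module K P] [AddCommGroup Q]
    [Module K Q] [AddCommGroup R] [Module K R] (X Y Z : D) (A : P →ₗ[K] (X ⟶ Z) →ₗ[K] R)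
    (A₁ : P →ₗ[K] (Y ⟶ Z) →ₗ[K] Q) (A₂ : Q →ₗ[K] (X ⟶ Y) →ₗ[K] R) (f : X ⟶ Y) (g : Y ⟶ Z)
    (hA : ∀ p (g : Y ⟶ Z) (f : X ⟶ Y), A p (f ≫ g) = A₂ (A₁ p g) f) (t : P ⊗[K] C) :
    twistedAction (E.ψ X Z) A (f ≫ g) t =
      twistedAction (E.ψ X Y) A₂ f (twistedAction (E.ψ Y Z) A₁ g t) := by
  induction t with
  | zero => simp
  | add s t hs ht => simp only [map_add, hs, ht]
  | tmul m c =>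
    simp only [twistedAction_tmul, E.ψ_comp]
    induction E.ψ Y Z (c ⊗ₜ[K] g) with
    | zero => simp
    | add s t hs ht => simp only [map_add, hs, ht]
    | tmul g' c' =>
      simp only [twistedAction_tmul, LinearMap.rTensor_tmul]
      induction E.ψ X Y (c' ⊗ₜ[K] f) with
      | zero => simp
      | add s t hs ht => simp only [map_add, hs, ht]
      | tmul f' c'' => simp [hA]

theorem rTensor_twistedAction {P Q P' Q' : Type u} [AddCommGroup P] [Module K P] [AddCommGroup Q]
    [Module K Q] [AddCommGroup P'] [Module K P'] [AddCommGroup Q'] [Module K Q'] (Y X : D)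
    (A : P →ₗ[K] (Y ⟶ X) →ₗ[K] Q) (A' : P' →ₗ[K] (Y ⟶ X) →ₗ[K] Q') (a : P →ₗ[K] P')
    (b : Q →ₗ[K] Q') (h : ∀ p f, b (A p f) = A' (a p) f) (f : Y ⟶ X) (t : P ⊗[K] C) :
    b.rTensor C (twistedAction (E.ψ Y X) A f t) =
      twistedAction (E.ψ Y X) A' f (a.rTensor C t) := by
  induction t with
  | zero => simp
  | add s t hs ht => simp only [map_add, hs, ht]
  | tmul m c =>
    simp only [LinearMap.rTensor_tmul, twistedAction_tmul]
    rw [← LinearMap.rTensor_comp_apply]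
    congr 2
    ext g
    exact h m g

/-- The coaction `p ⊗ c ↦ p ⊗ c₁ ⊗ c₂` of `C` on `P ⊗ C`. -/
def cofreeCoaction (C : Type u) [AddCommGroup C] [Module K C] [Coalgebra K C]
    (P : Type u) [AddCommGroup P] [Module K P] :
    P ⊗[K] C →ₗ[K] (P ⊗[K] C) ⊗[K] C :=
  (TensorProduct.assoc K P C C).symm.toLinearMap ∘ₗ
    (Coalgebra.comul (R := K) (A := C)).lTensor P

theorem cofreeCoaction_tmul (P : Type u) [AddCommGroup P] [Module K P] (p : P) (c : C) :
    cofreeCoaction (K := K) C P (p ⊗ₜ[K] c) =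
      (TensorProduct.mk K P C p).rTensor C (Coalgebra.comul (R := K) c) := by
  simp only [cofreeCoaction, LinearMap.comp_apply, LinearMap.lTensor_tmul]
  induction (Coalgebra.comul (R := K) c) with
  | zero => simp
  | add s t hs ht => simp only [TensorProduct.tmul_add, map_add, hs, ht]
  | tmul a b => simp

theorem isRightCoaction_cofreeCoaction (P : Type u) [AddCommGroup P] [Module K P] :
    IsRightCoaction (cofreeCoaction (K := K) C P) where
  coassoc t := by
    induction t with
    | zero => simp
    | add s t hs ht => simp only [map_add, hs, ht]
    | tmul p c =>
      have e : cofreeCoaction (K := K) C P ∘ₗ TensorProduct.mk K P C p =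
          (TensorProduct.mk K P C p).rTensor C ∘ₗ Coalgebra.comul := by
        ext c
        exact cofreeCoaction_tmul P p c
      have n : ∀ s : (C ⊗[K] C) ⊗[K] C, TensorProduct.assoc K (P ⊗[K] C) C C
          (((TensorProduct.mk K P C p).rTensor C).rTensor C s) =
          (TensorProduct.mk K P C p).rTensor (C ⊗[K] C) (TensorProduct.assoc K C C C s) := by
        intro s
        rw [← LinearEquiv.coe_coe, ← LinearEquiv.coe_coe, ← LinearMap.comp_apply,
          ← LinearMap.comp_apply]
        congr 1
        ext a b d
        simp
      have l : ∀ s : C ⊗[K] C, (TensorProduct.mk K P C p).rTensor (C ⊗[K] C)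
          ((Coalgebra.comul (R := K) (A := C)).lTensor C s) =
          (Coalgebra.comul (R := K) (A := C)).lTensor (P ⊗[K] C)
            ((TensorProduct.mk K P C p).rTensor C s) := by
        intro s
        rw [← LinearMap.comp_apply, ← LinearMap.comp_apply, LinearMap.rTensor_comp_lTensor,
          LinearMap.lTensor_comp_rTensor]
      rw [cofreeCoaction_tmul, ← LinearMap.rTensor_comp_apply, e, LinearMap.rTensor_comp_apply, n,
        Coalgebra.coassoc_apply, l]
  counit t := by
    induction t with
    | zero => simp
    | add s t hs ht => simp only [map_add, hs, ht]
    | tmul p c =>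
      have h := congrArg (fun s => p ⊗ₜ[K] TensorProduct.rid K C s)
        (Coalgebra.lTensor_counit_comul (R := K) c)
      simp only [TensorProduct.rid_tmul, one_smul] at h
      rw [cofreeCoaction_tmul, ← h]
      induction (Coalgebra.comul (R := K) c) with
      | zero => simp
      | add s t hs ht => simp only [TensorProduct.tmul_add, map_add, hs, ht]
      | tmul a b => simp

/-- The right module `M ⊗ C`, with `(M ⊗ C)(X) = M(X) ⊗ C` and
`(M ⊗ C)(f)(m ⊗ c) = M(f_ψ)(m) ⊗ c^ψ`. -/
abbrev tensorModule : RightModule K D where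
  obj :=
    { obj := fun X => ModuleCat.of K (M.fiber X.unop ⊗[K] C)
      map := fun {X Y} f =>
        ModuleCat.ofHom (twistedAction (E.ψ Y.unop X.unop) (M.act Y.unop X.unop) f.unop)
      map_id := by
        intro X
        apply ModuleCat.hom_ext; apply LinearMap.ext; intro t
        exact twistedAction_id E X.unop (M.act X.unop X.unop)
          (fun m => by simp [RightModule.act]) t
      map_comp := by
        intro X Y Z f g
        apply ModuleCat.hom_ext; apply LinearMap.ext; intro t
        exact twistedAction_comp E _ _ _ _ (M.act _ _) (M.act _ _) g.unop f.unop
          (fun m g f => by simp [RightModule.act]) t }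
  property := by
    constructor
    · intro Y X f g
      apply ModuleCat.hom_ext; apply LinearMap.ext; intro t
      exact LinearMap.congr_fun (twistedAction_add (E.ψ Y X) (M.act Y X) f g) t
    · intro Y X r f
      apply ModuleCat.hom_ext; apply LinearMap.ext; intro t
      exact LinearMap.congr_fun (twistedAction_smul (E.ψ Y X) (M.act Y X) r f) t

theorem cofreeCoaction_rTensor {P Q : Type u} [AddCommGroup P] [Module K P] [AddCommGroup Q]
    [Module K Q] (a : P →ₗ[K] Q) (t : P ⊗[K] C) :
    cofreeCoaction (K := K) C Q (a.rTensor C t) =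
      (a.rTensor C).rTensor C (cofreeCoaction (K := K) C P t) := by
  induction t with
  | zero => simp
  | add s t hs ht => simp only [map_add, hs, ht]
  | tmul p c =>
    simp only [LinearMap.rTensor_tmul, cofreeCoaction_tmul]
    rw [← LinearMap.rTensor_comp_apply]
    rfl

theorem cofreeCoaction_compat {P Q : Type u} [AddCommGroup P] [Module K P] [AddCommGroup Q]
    [Module K Q] (Y X : D) (A : P →ₗ[K] (Y ⟶ X) →ₗ[K] Q)
    (B : P ⊗[K] C →ₗ[K] (Y ⟶ X) →ₗ[K] Q ⊗[K] C)
    (hB : ∀ t f, B t f = twistedAction (E.ψ Y X) A f t) (f : Y ⟶ X) (t : P ⊗[K] C) :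
    cofreeCoaction (K := K) C Q (twistedAction (E.ψ Y X) A f t) =
      twistedAction (E.ψ Y X) B f (cofreeCoaction (K := K) C P t) := by
  induction t with
  | zero => simp
  | add s t hs ht => simp only [map_add, hs, ht]
  | tmul m c =>
    have h := E.ψ_comul Y X f c
    rw [twistedAction_tmul, cofreeCoaction_rTensor, cofreeCoaction_tmul]
    simp only [cofreeCoaction, LinearMap.comp_apply]
    rw [h]
    simp only [LinearEquiv.coe_coe, LinearEquiv.symm_apply_apply]
    induction (Coalgebra.comul (R := K) c) with
    | zero => simp
    | add s t hs ht => simp only [TensorProduct.add_tmul, map_add, hs, ht]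
    | tmul a b =>
      simp only [TensorProduct.assoc_tmul, LinearMap.lTensor_tmul, LinearMap.rTensor_tmul,
        TensorProduct.mk_apply]
      rw [twistedAction_tmul]
      induction E.ψ Y X (b ⊗ₜ[K] f) with
      | zero => simp
      | add s t hs ht => simp only [TensorProduct.tmul_add, map_add, hs, ht]
      | tmul g e =>
        simp only [TensorProduct.assoc_symm_tmul, LinearMap.rTensor_tmul,
          hB, twistedAction_tmul]

/-- The entwined module `M ⊗ C`, with coaction `m ⊗ c ↦ m ⊗ c₁ ⊗ c₂`. -/
abbrev cofreeModule : EntwinedModule E where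
  toModule := tensorModule E M
  ρ X := cofreeCoaction C (M.fiber X)
  isRightCoaction X := isRightCoaction_cofreeCoaction (M.fiber X)
  compat Y X f t :=
    cofreeCoaction_compat E Y X (M.act Y X) ((tensorModule E M).act Y X) (fun _ _ => rfl) f t

end CofreeModule

/-- The functor `𝓖 = - ⊗ C`, sending `φ` to `φ ⊗ id_C`. -/
abbrev cofree (E : Entwining K D C) : RightModule K D ⥤ EntwinedModule E where
  obj M := cofreeModule E M
  map {M N} φ :=
    { hom := ObjectProperty.homMk
        { app := fun X => ModuleCat.ofHom ((RightModule.component φ X.unop).rTensor C)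
          naturality := by
            intro X Y f
            apply ModuleCat.hom_ext; apply LinearMap.ext; intro t
            exact rTensor_twistedAction E Y.unop X.unop (M.act _ _) (N.act _ _)
              (RightModule.component φ X.unop) (RightModule.component φ Y.unop)
              (fun m g => ConcreteCategory.congr_hom (φ.hom.naturality g.op) m) f.unop t }
      colinear := by
        intro X t
        exact cofreeCoaction_rTensor (RightModule.component φ X) t }
  map_id := by
    intro M
    apply EntwinedModule.Hom.ext
    apply ObjectProperty.hom_ext
    ext X : 2
    apply ModuleCat.hom_ext
    exact LinearMap.rTensor_id C (M.fiber X.unop)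
  map_comp := by
    intro M N L φ χ
    apply EntwinedModule.Hom.ext
    apply ObjectProperty.hom_ext
    ext X : 2
    apply ModuleCat.hom_ext
    exact LinearMap.rTensor_comp C (RightModule.component χ X.unop) (RightModule.component φ X.unop)

variable (K D)

/-- The bimodule `h(X, Y) = Hom(X, Y)`, with `h(φ', φ'')(f) = φ'' f φ'`. Functors on
`Dᵒᵖ ⊗ D` are treated as functors on `Dᵒᵖ × D` that are `K`-linear in each variable; natural
transformations are the same. -/
abbrev homBimodule : Dᵒᵖ × D ⥤ ModuleCat.{u} K where
  obj p := ModuleCat.of K (p.1.unop ⟶ p.2)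
  map {p q} φ := ModuleCat.ofHom
    (Linear.rightComp K q.1.unop φ.2 ∘ₗ Linear.leftComp K p.2 φ.1.unop)
  map_id := by
    intro p
    ext f
    simp
  map_comp := by
    intro p q r φ χ
    ext f
    simp

variable {K D}

/-- The bimodule `(h ⊗ C)(X, Y) = Hom(X, Y) ⊗ C`, with
`(h ⊗ C)(φ', φ'')(f ⊗ c) = φ'' f φ'_ψ ⊗ c^ψ`. -/
abbrev homTensorBimodule (E : Entwining K D C) : Dᵒᵖ × D ⥤ ModuleCat.{u} K where
  obj p := ModuleCat.of K ((p.1.unop ⟶ p.2) ⊗[K] C)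
  map {p q} φ := ModuleCat.ofHom
    ((Linear.rightComp K q.1.unop φ.2).rTensor C ∘ₗ
      twistedAction (E.ψ q.1.unop p.1.unop) (homComp K D q.1.unop p.1.unop p.2) φ.1.unop)
  map_id := by
    intro p
    apply ModuleCat.hom_ext; apply LinearMap.ext; intro t
    have h := twistedAction_id E p.1.unop (homComp K D p.1.unop p.1.unop p.2) (by simp) t
    have e : Linear.rightComp K p.1.unop (𝟙 p.2) = LinearMap.id := by ext f; simp
    simpa [e] using h
  map_comp := by
    intro p q r φ χ
    apply ModuleCat.hom_ext; apply LinearMap.ext; intro t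
    have h := twistedAction_comp E r.1.unop q.1.unop p.1.unop (homComp K D r.1.unop p.1.unop p.2)
      (homComp K D q.1.unop p.1.unop p.2) (homComp K D r.1.unop q.1.unop p.2) χ.1.unop φ.1.unop
      (by simp) t
    have k := rTensor_twistedAction E r.1.unop q.1.unop (homComp K D r.1.unop q.1.unop p.2)
      (homComp K D r.1.unop q.1.unop q.2) (Linear.rightComp K q.1.unop φ.2)
      (Linear.rightComp K r.1.unop φ.2) (by simp) χ.1.unop
      (twistedAction (E.ψ q.1.unop p.1.unop) (homComp K D q.1.unop p.1.unop p.2) φ.1.unop t)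
    have e : Linear.rightComp K r.1.unop (φ.2 ≫ χ.2) =
        Linear.rightComp K r.1.unop χ.2 ∘ₗ Linear.rightComp K r.1.unop φ.2 := by ext f; simp
    change (Linear.rightComp K r.1.unop (φ.2 ≫ χ.2)).rTensor C
      (twistedAction (E.ψ r.1.unop p.1.unop) (homComp K D r.1.unop p.1.unop p.2)
        (χ.1.unop ≫ φ.1.unop) t) = (Linear.rightComp K r.1.unop χ.2).rTensor C
      (twistedAction (E.ψ r.1.unop q.1.unop) (homComp K D r.1.unop q.1.unop q.2) χ.1.unop
        ((Linear.rightComp K q.1.unop φ.2).rTensor C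
          (twistedAction (E.ψ q.1.unop p.1.unop) (homComp K D q.1.unop p.1.unop p.2)
            φ.1.unop t)))
    rw [e, LinearMap.rTensor_comp_apply, h, k]

/-- The space `W₁ = Nat(h, h ⊗ C)`. -/
abbrev W₁ (E : Entwining K D C) := homBimodule K D ⟶ homTensorBimodule E

/-- The linear map `η(X, Y) : Hom(X, Y) → Hom(X, Y) ⊗ C`. -/
abbrev W₁.component {E : Entwining K D C} (η : W₁ E) (X Y : D) : (X ⟶ Y) →ₗ[K] (X ⟶ Y) ⊗[K] C :=
  (η.app (op X, Y)).hom

/-- For `t : C ⊗ C → End(X)` and `d : C`, the linear map `Hom(X, Y) ⊗ C → Hom(X, Y)`,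
`g ⊗ c ↦ g_ψ ∘ t(d^ψ ⊗ c)`, where `ψ (d ⊗ g) = g_ψ ⊗ d^ψ`. -/
def evalTwisted (E : Entwining K D C) {X : D} (t : C ⊗[K] C →ₗ[K] (X ⟶ X)) (Y : D) (d : C) :
    (X ⟶ Y) ⊗[K] C →ₗ[K] (X ⟶ Y) :=
  TensorProduct.lift (LinearMap.mk₂ K (fun g c => evalRight t Y c (E.ψ X Y (d ⊗ₜ[K] g)))
    (by intros; simp [TensorProduct.tmul_add])
    (by intros; simp)
    (by intros; simp [evalRight_add])
    (by intros; simp [evalRight_smul]))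

@[simp]
theorem evalTwisted_tmul (E : Entwining K D C) {X : D} (t : C ⊗[K] C →ₗ[K] (X ⟶ X)) (Y : D)
    (d : C) (g : X ⟶ Y) (c : C) :
    evalTwisted E t Y d (g ⊗ₜ[K] c) = evalRight t Y c (E.ψ X Y (d ⊗ₜ[K] g)) := rfl

/-- The space `V₁` of families of linear maps `θ_X : C ⊗ C → End(X)` subject to two identities. -/
structure V₁ (E : Entwining K D C) where
  /-- the linear maps `θ_X` -/
  θ : ∀ X : D, C ⊗[K] C →ₗ[K] (X ⟶ X)
  /-- `θ_X(c ⊗ d) ∘ f = (f_ψ)_ψ ∘ θ_Y(c^ψ ⊗ d^ψ)`, where `ψ` is applied first with `d` and then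
  with `c` -/
  θ_comp : ∀ (Y X : D) (f : Y ⟶ X) (c d : C),
    f ≫ θ X (c ⊗ₜ[K] d) = evalTwisted E (θ Y) X c (E.ψ Y X (d ⊗ₜ[K] f))
  /-- `θ_X(c ⊗ d₁) ⊗ d₂ = (θ_X(c₂ ⊗ d))_ψ ⊗ (c₁)^ψ` -/
  θ_comul : ∀ (X : D) (c d : C),
    (θ X ∘ₗ TensorProduct.mk K C C c).rTensor C (Coalgebra.comul (R := K) d) =
      E.ψ X X ((θ X ∘ₗ (TensorProduct.mk K C C).flip d).lTensor C (Coalgebra.comul (R := K) c))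

end Category

section Frobenius

variable {A B : Type*} [Category* A] [Category* B]

/-- `(F, G)` is a Frobenius pair if `G` is both a right and a left adjoint of `F`. -/
def IsFrobeniusPair (F : A ⥤ B) (G : B ⥤ A) : Prop := Nonempty (F ⊣ G) ∧ Nonempty (G ⊣ F)

end Frobenius

end Entwined

namespace Entwined

section Linear

variable {K : Type*} [Field K] {C H P Q P' Q' : Type*}
  [AddCommGroup C] [Module K C] [AddCommGroup H] [Module K H]
  [AddCommGroup P] [Module K P] [AddCommGroup Q] [Module K Q]
  [AddCommGroup P'] [Module K P'] [AddCommGroup Q'] [Module K Q']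

/-- For `A : P × H → Q` bilinear and `t : C ⊗ C → H`, the linear map
`(p ⊗ c) ⊗ d ↦ A (p, t (c ⊗ d))`. -/
def pairing (A : P →ₗ[K] H →ₗ[K] Q) (t : C ⊗[K] C →ₗ[K] H) : (P ⊗[K] C) ⊗[K] C →ₗ[K] Q :=
  TensorProduct.lift A ∘ₗ t.lTensor P ∘ₗ (TensorProduct.assoc K P C C).toLinearMap

@[simp]
theorem pairing_tmul (A : P →ₗ[K] H →ₗ[K] Q) (t : C ⊗[K] C →ₗ[K] H) (p : P) (c d : C) :
    pairing A t ((p ⊗ₜ[K] c) ⊗ₜ[K] d) = A p (t (c ⊗ₜ[K] d)) := by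
  simp [pairing]

theorem pairing_rTensor (A : P →ₗ[K] H →ₗ[K] Q) (A' : P' →ₗ[K] H →ₗ[K] Q') (t : C ⊗[K] C →ₗ[K] H)
    (a : P →ₗ[K] P') (b : Q →ₗ[K] Q') (h : ∀ p f, b (A p f) = A' (a p) f)
    (s : (P ⊗[K] C) ⊗[K] C) :
    b (pairing A t s) = pairing A' t ((a.rTensor C).rTensor C s) := by
  induction s with
  | zero => simp
  | add s t hs ht => simp only [map_add, hs, ht]
  | tmul s d =>
    induction s with
    | zero => simp
    | add s t hs ht => simp only [map_add, TensorProduct.add_tmul, hs, ht]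
    | tmul p c => simp [h]

variable [Coalgebra K C]

variable (K C P) in
/-- The linear map `p ⊗ c ↦ ε(c) p`. -/
def tensorCounit : P ⊗[K] C →ₗ[K] P :=
  (TensorProduct.rid K P).toLinearMap ∘ₗ (Coalgebra.counit (R := K) (A := C)).lTensor P

@[simp]
theorem tensorCounit_tmul (p : P) (c : C) :
    tensorCounit K C P (p ⊗ₜ[K] c) = Coalgebra.counit (R := K) c • p := by
  simp [tensorCounit]

theorem tensorCounit_rTensor (a : P →ₗ[K] Q) (t : P ⊗[K] C) :
    tensorCounit K C Q (a.rTensor C t) = a (tensorCounit K C P t) := by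
  induction t with
  | zero => simp
  | add s t hs ht => simp only [map_add, hs, ht]
  | tmul p c => simp

theorem IsRightCoaction.tensorCounit_apply {ρ : P →ₗ[K] P ⊗[K] C} (h : IsRightCoaction ρ) (p : P) :
    tensorCounit K C P (ρ p) = p := h.counit p

end Linear

variable {K : Type u} [Field K] {D : Type v} [Category.{u} D] [Preadditive D] [Linear K D]
  {C : Type u} [AddCommGroup C] [Module K C] [Coalgebra K C]

section Cofree

variable {P : Type u} [AddCommGroup P] [Module K P]

theorem IsRightCoaction.cofreeCoaction_apply {ρ : P →ₗ[K] P ⊗[K] C} (h : IsRightCoaction ρ)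
    (p : P) : cofreeCoaction C P (ρ p) = ρ.rTensor C (ρ p) := by
  rw [cofreeCoaction, LinearMap.comp_apply, ← h.coassoc p]
  simp

theorem rTensor_tensorCounit_cofreeCoaction (t : P ⊗[K] C) :
    (tensorCounit K C P).rTensor C (cofreeCoaction C P t) = t := by
  induction t with
  | zero => simp
  | add s t hs ht => simp only [map_add, hs, ht]
  | tmul p c =>
    have h := congrArg (fun s => p ⊗ₜ[K] TensorProduct.lid K C s)
      (Coalgebra.rTensor_counit_comul (R := K) c)
    simp only [TensorProduct.lid_tmul, one_smul] at h
    rw [cofreeCoaction_tmul, ← h]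
    induction (Coalgebra.comul (R := K) c) with
    | zero => simp
    | add s t hs ht => simp only [TensorProduct.tmul_add, map_add, hs, ht]
    | tmul a b => simp [TensorProduct.smul_tmul]

variable {Q : Type u} [AddCommGroup Q] [Module K Q]

theorem tensorCounit_twistedAction (E : Entwining K D C) {Y X : D} (A : P →ₗ[K] (Y ⟶ X) →ₗ[K] Q)
    (f : Y ⟶ X) (t : P ⊗[K] C) :
    tensorCounit K C Q (twistedAction (E.ψ Y X) A f t) = A (tensorCounit K C P t) f := by
  induction t with
  | zero => simp
  | add s t hs ht => simp only [map_add, hs, ht, LinearMap.add_apply]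
  | tmul p c =>
    have h : tensorCounit K C _ (E.ψ Y X (c ⊗ₜ[K] f)) = _ := E.ψ_counit Y X f c
    rw [twistedAction_tmul, tensorCounit_rTensor, h]
    simp

end Cofree

section Adjunction

variable (E : Entwining K D C)

/-- A morphism of right modules from its components. -/
def RightModule.mkHom {M N : RightModule K D} (φ : ∀ X, M.fiber X →ₗ[K] N.fiber X)
    (h : ∀ (Y X : D) (f : Y ⟶ X) (m : M.fiber X),
      φ Y ((M.obj.map f.op).hom m) = (N.obj.map f.op).hom (φ X m)) : M ⟶ N :=
  ObjectProperty.homMk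
    { app := fun X => ModuleCat.ofHom (φ X.unop)
      naturality := by
        intro X Y f
        apply ModuleCat.hom_ext; apply LinearMap.ext; intro m
        exact h Y.unop X.unop f.unop m }

theorem RightModule.hom_ext {M N : RightModule K D} {φ χ : M ⟶ N}
    (h : ∀ X (m : M.fiber X), RightModule.component φ X m = RightModule.component χ X m) :
    φ = χ := by
  apply ObjectProperty.hom_ext
  ext X m
  exact h X.unop m

theorem RightModule.component_map {M N : RightModule K D} (φ : M ⟶ N) {Y X : D} (f : Y ⟶ X)
    (m : M.fiber X) :
    RightModule.component φ Y ((M.obj.map f.op).hom m) =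
      (N.obj.map f.op).hom (RightModule.component φ X m) :=
  ConcreteCategory.congr_hom (φ.hom.naturality f.op) m

/-- The coaction of an entwined module `M`, as a morphism `M ⟶ M ⊗ C` of entwined modules. -/
def coactionHom (M : EntwinedModule E) : M ⟶ cofreeModule E M.toModule where
  hom := RightModule.mkHom M.ρ fun Y X f m => M.compat Y X f m
  colinear X m := (M.isRightCoaction X).cofreeCoaction_apply m

/-- The morphism `n ⊗ c ↦ ε(c) n` of right modules `N ⊗ C ⟶ N`. -/
def counitHom (N : RightModule K D) : tensorModule E N ⟶ N :=
  RightModule.mkHom (fun X => tensorCounit K C (N.fiber X))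
    fun Y X f t => tensorCounit_twistedAction E (N.act Y X) f t

/-- The adjunction between the forgetful functor and `- ⊗ C`. -/
def forgetfulAdjunction : forgetful E ⊣ cofree E :=
  Adjunction.mkOfUnitCounit
    { unit :=
        { app := fun M => coactionHom E M
          naturality := by
            intro M N φ
            apply EntwinedModule.Hom.ext
            apply RightModule.hom_ext
            intro X m
            exact φ.colinear X m }
      counit :=
        { app := fun N => counitHom E N
          naturality := by
            intro M N φ
            apply RightModule.hom_ext
            intro X t
            exact tensorCounit_rTensor (RightModule.component φ X) t }
      left_triangle := by
        ext M : 2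
        apply RightModule.hom_ext
        intro X m
        exact (M.isRightCoaction X).tensorCounit_apply m
      right_triangle := by
        ext N : 2
        apply EntwinedModule.Hom.ext
        apply RightModule.hom_ext
        intro X t
        exact rTensor_tensorCounit_cofreeCoaction t }

end Adjunction

section Yoneda

variable (K) in
/-- The representable right module `Hom(-, Y)`. -/
abbrev homModule (Y : D) : RightModule K D where
  obj :=
    { obj := fun X => ModuleCat.of K (X.unop ⟶ Y)
      map := fun f => ModuleCat.ofHom (Linear.leftComp K Y f.unop)
      map_id := by intro X; ext f; simp
      map_comp := by intro X Z W f g; ext h; simp }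
  property := by
    constructor
    · intro X Z f g
      ext h
      simp
    · intro X Z r f
      ext h
      simp

/-- The morphism `Hom(-, X) ⟶ M` determined by an element of `M(X)`. -/
def homModuleDesc (M : RightModule K D) {X : D} (m : M.fiber X) : homModule K X ⟶ M :=
  RightModule.mkHom (fun Y => M.act Y X m) (by
    intro Z Y f g
    change (M.obj.map (f ≫ g).op).hom m = _
    simp
    rfl)

end Yoneda

end Entwined

namespace Entwined

variable {K : Type u} [Field K] {D : Type v} [Category.{u} D] [Preadditive D] [Linear K D]
  {C : Type u} [AddCommGroup C] [Module K C]

theorem evalRight_eq_pairing {X : D} (t : C ⊗[K] C →ₗ[K] (X ⟶ X)) (Y : D) (d : C)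
    (s : (X ⟶ Y) ⊗[K] C) :
    evalRight t Y d s = pairing (homComp K D X X Y) t (s ⊗ₜ[K] d) := by
  induction s with
  | zero => simp
  | add s t hs ht => simp only [map_add, TensorProduct.add_tmul, hs, ht]
  | tmul g c => simp

variable [Coalgebra K C] {E : Entwining K D C}

section Pairing

variable {P Q R : Type u} [AddCommGroup P] [Module K P] [AddCommGroup Q] [Module K Q]
  [AddCommGroup R] [Module K R]

theorem pairing_rTensor_evalTwisted {X Y : D} (t : C ⊗[K] C →ₗ[K] (X ⟶ X))
    (A : P →ₗ[K] (X ⟶ Y) →ₗ[K] Q) (A₂ : Q →ₗ[K] (X ⟶ X) →ₗ[K] R) (A₃ : P →ₗ[K] (X ⟶ Y) →ₗ[K] R)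
    (hA : ∀ p g k, A₂ (A p g) k = A₃ p (k ≫ g))
    (B : P ⊗[K] C →ₗ[K] (X ⟶ Y) →ₗ[K] Q ⊗[K] C)
    (hB : ∀ u g, B u g = twistedAction (E.ψ X Y) A g u) (p : P) (d : C) (s : (X ⟶ Y) ⊗[K] C) :
    pairing A₂ t ((B (p ⊗ₜ[K] d)).rTensor C s) = A₃ p (evalTwisted E t Y d s) := by
  induction s with
  | zero => simp
  | add s t hs ht => simp only [map_add, hs, ht]
  | tmul g c =>
    rw [LinearMap.rTensor_tmul, hB, twistedAction_tmul, evalTwisted_tmul]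
    induction E.ψ X Y (d ⊗ₜ[K] g) with
    | zero => simp
    | add s t hs ht => simp only [map_add, TensorProduct.add_tmul, hs, ht]
    | tmul g' d' => simp [hA]

theorem pairing_cofreeCoaction (θ : V₁ E) {X : D} (A : P →ₗ[K] (X ⟶ X) →ₗ[K] Q)
    (B : P ⊗[K] C →ₗ[K] (X ⟶ X) →ₗ[K] Q ⊗[K] C)
    (hB : ∀ u g, B u g = twistedAction (E.ψ X X) A g u) (s : P ⊗[K] C) (d : C) :
    pairing B (θ.θ X) (cofreeCoaction C P s ⊗ₜ[K] d) =
      (pairing A (θ.θ X)).rTensor C (cofreeCoaction C (P ⊗[K] C) (s ⊗ₜ[K] d)) := by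
  induction s with
  | zero => simp
  | add s t hs ht => simp only [map_add, TensorProduct.add_tmul, hs, ht]
  | tmul p c =>
    have e : pairing A (θ.θ X) ∘ₗ TensorProduct.mk K (P ⊗[K] C) C (p ⊗ₜ[K] c) =
        A p ∘ₗ θ.θ X ∘ₗ TensorProduct.mk K C C c := by
      ext d
      simp
    rw [cofreeCoaction_tmul, cofreeCoaction_tmul, ← LinearMap.rTensor_comp_apply, e,
      LinearMap.rTensor_comp_apply, θ.θ_comul]
    induction Coalgebra.comul (R := K) c with
    | zero => simp
    | add s t hs ht => simp only [map_add, TensorProduct.add_tmul, hs, ht]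
    | tmul a b => simp [hB]

end Pairing

namespace W₁

variable (η : W₁ E)

theorem component_comp {X Y Z : D} (f : X ⟶ Y) (g : Y ⟶ Z) :
    η.component X Z (f ≫ g) = (Linear.rightComp K X g).rTensor C (η.component X Y f) := by
  have h := ConcreteCategory.congr_hom
    (η.naturality ((𝟙 (op X), g) : ((op X, Y) : Dᵒᵖ × D) ⟶ (op X, Z))) f
  have k := twistedAction_id E X (homComp K D X X Y) (by simp) (η.component X Y f)
  change η.component X Z ((𝟙 X ≫ f) ≫ g) = (Linear.rightComp K X g).rTensor C
    (twistedAction (E.ψ X X) (homComp K D X X Y) (𝟙 X) (η.component X Y f)) at h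
  rwa [k, Category.id_comp] at h

theorem component_comp' {X Y Z : D} (f : X ⟶ Y) (g : Y ⟶ Z) :
    η.component X Z (f ≫ g) =
      twistedAction (E.ψ X Y) (homComp K D X Y Z) f (η.component Y Z g) := by
  have h := ConcreteCategory.congr_hom
    (η.naturality ((f.op, 𝟙 Z) : ((op Y, Z) : Dᵒᵖ × D) ⟶ (op X, Z))) g
  have k : Linear.rightComp K X (𝟙 Z) = LinearMap.id := by ext f; simp
  change η.component X Z ((f ≫ g) ≫ 𝟙 Z) = (Linear.rightComp K X (𝟙 Z)).rTensor C
    (twistedAction (E.ψ X Y) (homComp K D X Y Z) f (η.component Y Z g)) at h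
  rwa [k, LinearMap.rTensor_id_apply, Category.comp_id] at h

/-- The natural transformation `n ↦ N(f̂)(n) ⊗ c_f`, where `η(id) = f̂ ⊗ c_f`. -/
def natTrans : 𝟭 (RightModule K D) ⟶ cofree E ⋙ forgetful E where
  app N := RightModule.mkHom (N := tensorModule E N)
    (fun X => (LinearMap.rTensorHom C ∘ₗ N.act X X).flip (η.component X X (𝟙 X))) (by
      intro Y X f n
      change (N.act Y Y ((N.obj.map f.op).hom n)).rTensor C (η.component Y Y (𝟙 Y)) =
        twistedAction (E.ψ Y X) (N.act Y X) f ((N.act X X n).rTensor C (η.component X X (𝟙 X)))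
      have e : N.act Y Y ((N.obj.map f.op).hom n) = N.act Y X n ∘ₗ Linear.rightComp K Y f := by
        ext g
        simp
      rw [← rTensor_twistedAction E Y X (homComp K D Y X X) (N.act Y X) (N.act X X n)
        (N.act Y X n) (by simp), ← component_comp', e, LinearMap.rTensor_comp_apply,
        ← component_comp, Category.id_comp, Category.comp_id])
  naturality := by
    intro M N φ
    apply RightModule.hom_ext
    intro X n
    change (N.act X X (RightModule.component φ X n)).rTensor C (η.component X X (𝟙 X)) =
      (RightModule.component φ X).rTensor C ((M.act X X n).rTensor C (η.component X X (𝟙 X)))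
    rw [← LinearMap.rTensor_comp_apply]
    congr 2
    ext g
    exact (RightModule.component_map φ g n).symm

theorem natTrans_apply (N : RightModule K D) (X : D) (n : N.fiber X) :
    RightModule.component (η.natTrans.app N) X n =
      (N.act X X n).rTensor C (η.component X X (𝟙 X)) := rfl

/-- The element of `W₁` given by the components at the representable modules. -/
def ofNatTrans (υ : 𝟭 (RightModule K D) ⟶ cofree E ⋙ forgetful E) : W₁ E where
  app p := ModuleCat.ofHom (RightModule.component (υ.app (homModule K p.2)) p.1.unop)
  naturality := by
    intro p q φ
    ext f
    let β : homModule K p.2 ⟶ homModule K q.2 := homModuleDesc (homModule K q.2) φ.2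
    have h := υ.naturality β
    have h₁ := congrArg (fun χ => RightModule.component χ q.1.unop (φ.1.unop ≫ f)) h
    have h₂ := RightModule.component_map (υ.app (homModule K p.2)) φ.1.unop f
    have e : RightModule.component β q.1.unop = Linear.rightComp K q.1.unop φ.2 := by
      ext g
      rfl
    change RightModule.component (υ.app (homModule K q.2)) q.1.unop ((φ.1.unop ≫ f) ≫ φ.2) =
      (RightModule.component β q.1.unop).rTensor C
        (RightModule.component (υ.app (homModule K p.2)) q.1.unop (φ.1.unop ≫ f)) at h₁
    rw [e] at h₁
    exact h₁.trans (congrArg _ h₂)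

theorem component_ofNatTrans (υ : 𝟭 (RightModule K D) ⟶ cofree E ⋙ forgetful E) {X Y : D}
    (f : X ⟶ Y) : (ofNatTrans υ).component X Y f =
      RightModule.component (υ.app (homModule K Y)) X f := rfl

end W₁

namespace V₁

variable (θ : V₁ E)

/-- The natural transformation `m ⊗ d ↦ M(θ(m₁ ⊗ d))(m₀)`. -/
def natTrans : forgetful E ⋙ cofree E ⟶ 𝟭 (EntwinedModule E) where
  app M :=
    { hom := RightModule.mkHom (M := tensorModule E M.toModule)
        (fun X => pairing (M.toModule.act X X) (θ.θ X) ∘ₗ (M.ρ X).rTensor C) (by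
          intro Y X f t
          change pairing (M.toModule.act Y Y) (θ.θ Y) ((M.ρ Y).rTensor C
            (twistedAction (E.ψ Y X) (M.toModule.act Y X) f t)) =
            M.toModule.act Y X (pairing (M.toModule.act X X) (θ.θ X) ((M.ρ X).rTensor C t)) f
          rw [rTensor_twistedAction E Y X (M.toModule.act Y X)
            ((tensorModule E M.toModule).act Y X) (M.ρ X) (M.ρ Y)
            (fun m f => M.compat Y X f m)]
          induction (M.ρ X).rTensor C t with
          | zero => simp
          | add s t hs ht => simp only [map_add, LinearMap.add_apply, hs, ht]
          | tmul s d =>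
            induction s with
            | zero => simp
            | add s t hs ht =>
              simp only [map_add, TensorProduct.add_tmul, LinearMap.add_apply, hs, ht]
            | tmul n c =>
              rw [twistedAction_tmul, pairing_rTensor_evalTwisted (E := E) (θ.θ Y)
                (M.toModule.act Y X) (M.toModule.act Y Y) (M.toModule.act Y X) (by simp)
                ((tensorModule E M.toModule).act Y X) (fun _ _ => rfl), ← θ.θ_comp]
              simp)
      colinear := by
        intro X (t : M.toModule.fiber X ⊗[K] C)
        change M.ρ X (pairing (M.toModule.act X X) (θ.θ X) ((M.ρ X).rTensor C t)) =
          (pairing (M.toModule.act X X) (θ.θ X) ∘ₗ (M.ρ X).rTensor C).rTensor C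
            (cofreeCoaction C (M.toModule.fiber X) t)
        rw [pairing_rTensor _ ((tensorModule E M.toModule).act X X) (θ.θ X) (M.ρ X) (M.ρ X)
            (fun m f => M.compat X X f m), LinearMap.rTensor_comp_apply, ← cofreeCoaction_rTensor]
        induction t with
        | zero => simp
        | add s t hs ht => simp only [map_add, hs, ht]
        | tmul m d =>
          rw [LinearMap.rTensor_tmul, LinearMap.rTensor_tmul,
            ← (M.isRightCoaction X).cofreeCoaction_apply]
          exact pairing_cofreeCoaction θ _ _ (fun _ _ => rfl) _ _ }
  naturality := by
    intro M N φ
    apply EntwinedModule.Hom.ext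
    apply RightModule.hom_ext
    intro X t
    change pairing (N.toModule.act X X) (θ.θ X) ((N.ρ X).rTensor C
      ((RightModule.component φ.hom X).rTensor C t)) = RightModule.component φ.hom X
        (pairing (M.toModule.act X X) (θ.θ X) ((M.ρ X).rTensor C t))
    rw [pairing_rTensor _ (N.toModule.act X X) (θ.θ X) (RightModule.component φ.hom X)
      (RightModule.component φ.hom X) (fun m f => RightModule.component_map φ.hom f m),
      ← LinearMap.rTensor_comp_apply, ← LinearMap.rTensor_comp_apply]
    congr 3
    ext m
    exact φ.colinear X m

theorem natTrans_apply (M : EntwinedModule E) (X : D) (t : M.toModule.fiber X ⊗[K] C) :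
    RightModule.component (θ.natTrans.app M).hom X t =
      pairing (M.toModule.act X X) (θ.θ X) ((M.ρ X).rTensor C t) := rfl

end V₁

end Entwined

namespace Entwined

variable {K : Type u} [Field K] {D : Type v} [Category.{u} D] [Preadditive D] [Linear K D]
  {C : Type u} [AddCommGroup C] [Module K C] [Coalgebra K C] {E : Entwining K D C}

section CounitTransformation

variable (κ : forgetful E ⋙ cofree E ⟶ 𝟭 (EntwinedModule E))

/-- The component at `M` and `X` of a natural transformation `𝓖𝓕 ⟶ id`. -/
def counitComponent (M : EntwinedModule E) (X : D) :
    M.toModule.fiber X ⊗[K] C →ₗ[K] M.toModule.fiber X :=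
  RightModule.component (κ.app M).hom X

theorem counitComponent_naturality {M N : EntwinedModule E} (φ : M ⟶ N) (X : D)
    (t : M.toModule.fiber X ⊗[K] C) :
    counitComponent κ N X ((RightModule.component φ.hom X).rTensor C t) =
      RightModule.component φ.hom X (counitComponent κ M X t) :=
  congrArg (fun χ => RightModule.component (EntwinedModule.Hom.hom χ) X t) (κ.naturality φ)

theorem counitComponent_map (M : EntwinedModule E) {Y X : D} (f : Y ⟶ X)
    (t : M.toModule.fiber X ⊗[K] C) :
    counitComponent κ M Y (twistedAction (E.ψ Y X) (M.toModule.act Y X) f t) =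
      (M.toModule.obj.map f.op).hom (counitComponent κ M X t) :=
  RightModule.component_map (κ.app M).hom f t

theorem counitComponent_colinear (M : EntwinedModule E) (X : D)
    (t : M.toModule.fiber X ⊗[K] C) :
    M.ρ X (counitComponent κ M X t) =
      (counitComponent κ M X).rTensor C (cofreeCoaction C (M.toModule.fiber X) t) :=
  (κ.app M).colinear X t

/-- The linear map `C ⊗ C → End(X)` determined by a natural transformation `𝓖𝓕 ⟶ id`. -/
def counitForm (X : D) : C ⊗[K] C →ₗ[K] (X ⟶ X) :=
  tensorCounit K C (X ⟶ X) ∘ₗ counitComponent κ (cofreeModule E (homModule K X)) X ∘ₗ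
    (TensorProduct.mk K (X ⟶ X) C (𝟙 X)).rTensor C

theorem counitForm_tmul (X : D) (c d : C) :
    counitForm κ X (c ⊗ₜ[K] d) = tensorCounit K C (X ⟶ X)
      (counitComponent κ (cofreeModule E (homModule K X)) X ((𝟙 X ⊗ₜ[K] c) ⊗ₜ[K] d)) := rfl

theorem tensorCounit_counitComponent (N : RightModule K D) (X : D)
    (s : (N.fiber X ⊗[K] C) ⊗[K] C) :
    tensorCounit K C (N.fiber X) (counitComponent κ (cofreeModule E N) X s) =
      pairing (N.act X X) (counitForm κ X) s := by
  induction s with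
  | zero => simp
  | add s t hs ht => simp only [map_add, hs, ht]
  | tmul s d =>
    induction s with
    | zero => simp
    | add s t hs ht => simp only [map_add, TensorProduct.add_tmul, hs, ht]
    | tmul n c =>
      have h := counitComponent_naturality κ ((cofree E).map (homModuleDesc N n)) X
        ((𝟙 X ⊗ₜ[K] c) ⊗ₜ[K] d)
      change counitComponent κ (cofreeModule E N) X ((N.act X X n (𝟙 X) ⊗ₜ[K] c) ⊗ₜ[K] d) =
        (N.act X X n).rTensor C
          (counitComponent κ (cofreeModule E (homModule K X)) X ((𝟙 X ⊗ₜ[K] c) ⊗ₜ[K] d)) at h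
      rw [RightModule.act_apply] at h
      simp only [op_id, CategoryTheory.Functor.map_id, ModuleCat.hom_id, LinearMap.id_apply] at h
      rw [h, tensorCounit_rTensor, pairing_tmul, counitForm_tmul]

theorem counitComponent_apply (M : EntwinedModule E) (X : D) (t : M.toModule.fiber X ⊗[K] C) :
    counitComponent κ M X t =
      pairing (M.toModule.act X X) (counitForm κ X) ((M.ρ X).rTensor C t) := by
  have h := counitComponent_naturality κ (coactionHom E M) X t
  change counitComponent κ (cofreeModule E M.toModule) X ((M.ρ X).rTensor C t) =
    M.ρ X (counitComponent κ M X t) at h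
  rw [← tensorCounit_counitComponent, h, (M.isRightCoaction X).tensorCounit_apply]

/-- The element of `V₁` determined by a natural transformation `𝓖𝓕 ⟶ id`. -/
def V₁.ofNatTrans : V₁ E where
  θ := counitForm κ
  θ_comp := by
    intro Y X f c d
    have h := congrArg (tensorCounit K C (Y ⟶ X)) (counitComponent_map κ
      (cofreeModule E (homModule K X)) f ((𝟙 X ⊗ₜ[K] c) ⊗ₜ[K] d))
    have h₁ := tensorCounit_twistedAction E ((homModule K X).act Y X) f
      (counitComponent κ (cofreeModule E (homModule K X)) X ((𝟙 X ⊗ₜ[K] c) ⊗ₜ[K] d))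
    have h₂ := tensorCounit_counitComponent κ (homModule K X) Y
      (twistedAction (E.ψ Y X) ((tensorModule E (homModule K X)).act Y X) f
        ((𝟙 X ⊗ₜ[K] c) ⊗ₜ[K] d))
    have h₃ := pairing_rTensor_evalTwisted (counitForm κ Y) ((homModule K X).act Y X)
      ((homModule K X).act Y Y) (homComp K D Y X X) (fun p g k => (Category.assoc k g p).symm)
      ((tensorModule E (homModule K X)).act Y X) (fun _ _ => rfl) (𝟙 X) c (E.ψ Y X (d ⊗ₜ[K] f))
    rw [homComp_apply, Category.comp_id] at h₃
    exact h₁.symm.trans (h.symm.trans (h₂.trans h₃))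
  θ_comul := by
    intro X c d
    have e₁ : counitForm κ X ∘ₗ TensorProduct.mk K C C c = tensorCounit K C (X ⟶ X) ∘ₗ
        counitComponent κ (cofreeModule E (homModule K X)) X ∘ₗ
          TensorProduct.mk K ((X ⟶ X) ⊗[K] C) C (𝟙 X ⊗ₜ[K] c) := by
      ext d
      rfl
    have h₁ := counitComponent_colinear κ (cofreeModule E (homModule K X)) X
      ((𝟙 X ⊗ₜ[K] c) ⊗ₜ[K] d)
    change cofreeCoaction C (X ⟶ X) _ =
      (counitComponent κ (cofreeModule E (homModule K X)) X).rTensor C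
        (cofreeCoaction C ((X ⟶ X) ⊗[K] C) ((𝟙 X ⊗ₜ[K] c) ⊗ₜ[K] d)) at h₁
    have h₂ := counitComponent_apply κ (cofreeModule E (homModule K X)) X
      ((𝟙 X ⊗ₜ[K] c) ⊗ₜ[K] d)
    change _ = pairing ((tensorModule E (homModule K X)).act X X) (counitForm κ X)
      (cofreeCoaction C (X ⟶ X) (𝟙 X ⊗ₜ[K] c) ⊗ₜ[K] d) at h₂
    rw [e₁, LinearMap.rTensor_comp_apply, LinearMap.rTensor_comp_apply, ← cofreeCoaction_tmul]
    refine (congrArg _ h₁.symm).trans ?_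
    refine (rTensor_tensorCounit_cofreeCoaction _).trans (h₂.trans ?_)
    rw [cofreeCoaction_tmul]
    induction Coalgebra.comul (R := K) c with
    | zero => simp
    | add s t hs ht => simp only [map_add, TensorProduct.add_tmul, hs, ht]
    | tmul a b =>
      simp only [LinearMap.rTensor_tmul, LinearMap.lTensor_tmul, pairing_tmul,
        TensorProduct.mk_apply]
      change twistedAction (E.ψ X X) ((homModule K X).act X X) (counitForm κ X (b ⊗ₜ[K] d))
        (𝟙 X ⊗ₜ[K] a) = _
      have e : (homModule K X).act X X (𝟙 X) = LinearMap.id := by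
        ext g
        simp
      rw [twistedAction_tmul, e, LinearMap.rTensor_id_apply]
      rfl

theorem V₁.ofNatTrans_θ (X : D) : (V₁.ofNatTrans κ).θ X = counitForm κ X := rfl

end CounitTransformation

/-- Compatibility of `θ` and `η`: `ε(d) f = f̂ ∘ θ(c_f ⊗ d)` and `ε(d) f = f̂_ψ ∘ θ(d^ψ ⊗ c_f)`. -/
def IsFrobeniusSystem (θ : V₁ E) (η : W₁ E) : Prop :=
  ∀ (X Y : D) (f : X ⟶ Y) (d : C),
    Coalgebra.counit (R := K) d • f = evalRight (θ.θ X) Y d (η.component X Y f) ∧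
    Coalgebra.counit (R := K) d • f = evalTwisted E (θ.θ X) Y d (η.component X Y f)

theorem isFrobeniusSystem_ofNatTrans (adj : cofree E ⊣ forgetful E) :
    IsFrobeniusSystem (V₁.ofNatTrans adj.counit) (W₁.ofNatTrans adj.unit) := by
  intro X Y f d
  rw [V₁.ofNatTrans_θ, W₁.component_ofNatTrans]
  constructor
  · have h := congrArg (fun χ => RightModule.component (EntwinedModule.Hom.hom χ) X (f ⊗ₜ[K] d))
      (adj.left_triangle_components (homModule K Y))
    change counitComponent adj.counit (cofreeModule E (homModule K Y)) X
      (RightModule.component (adj.unit.app (homModule K Y)) X f ⊗ₜ[K] d) = f ⊗ₜ[K] d at h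
    have h' := congrArg (tensorCounit K C (X ⟶ Y)) h
    rw [tensorCounit_tmul] at h'
    rw [evalRight_eq_pairing]
    exact h'.symm.trans (tensorCounit_counitComponent adj.counit (homModule K Y) X _)
  · let M := cofreeModule E (homModule K Y)
    let β : homModule K Y ⟶ M.toModule :=
      homModuleDesc M.toModule (X := Y) ((𝟙 Y : Y ⟶ Y) ⊗ₜ[K] d)
    have h₁ := congrArg (fun χ => RightModule.component χ X f) (adj.unit.naturality β)
    have h₂ := congrArg (fun χ => RightModule.component χ X (RightModule.component β X f))
      (adj.right_triangle_components M)
    have h₃ := pairing_rTensor_evalTwisted (counitForm adj.counit X) ((homModule K Y).act X Y)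
      ((homModule K Y).act X X) (homComp K D X Y Y) (fun p g k => (Category.assoc k g p).symm)
      ((tensorModule E (homModule K Y)).act X Y) (fun _ _ => rfl) (𝟙 Y) d
      (RightModule.component (adj.unit.app (homModule K Y)) X f)
    rw [homComp_apply, Category.comp_id] at h₃
    have h₄ := tensorCounit_twistedAction E ((homModule K Y).act X Y) f
      ((𝟙 Y : Y ⟶ Y) ⊗ₜ[K] d)
    rw [tensorCounit_tmul] at h₄
    change RightModule.component (adj.unit.app M.toModule) X (RightModule.component β X f) =
      (RightModule.component β X).rTensor C
        (RightModule.component (adj.unit.app (homModule K Y)) X f) at h₁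
    change counitComponent adj.counit M X (RightModule.component (adj.unit.app M.toModule) X
      (RightModule.component β X f)) = RightModule.component β X f at h₂
    rw [h₁] at h₂
    have h₅ := congrArg (tensorCounit K C (X ⟶ Y)) h₂
    refine Eq.trans ?_ (h₄.symm.trans (h₅.symm.trans
      ((tensorCounit_counitComponent adj.counit (homModule K Y) X _).trans h₃)))
    simp

/-- The adjunction determined by `θ` and `η`. -/
def IsFrobeniusSystem.adjunction {θ : V₁ E} {η : W₁ E} (h : IsFrobeniusSystem θ η) :
    cofree E ⊣ forgetful E :=
  Adjunction.mkOfUnitCounit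
    { unit := η.natTrans
      counit := θ.natTrans
      left_triangle := by
        ext N : 2
        apply EntwinedModule.Hom.ext
        apply RightModule.hom_ext
        intro X (t : N.fiber X ⊗[K] C)
        change pairing ((tensorModule E N).act X X) (θ.θ X) ((cofreeCoaction C (N.fiber X)).rTensor C
          ((RightModule.component (η.natTrans.app N) X).rTensor C t)) = t
        induction t with
        | zero => simp
        | add s t hs ht => rw [map_add, map_add, map_add, hs, ht]
        | tmul n d =>
          have e : pairing (N.act X X) (θ.θ X) ∘ₗ TensorProduct.mk K (N.fiber X ⊗[K] C) C
              ((N.act X X n).rTensor C (η.component X X (𝟙 X))) =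
              LinearMap.toSpanSingleton K (N.fiber X) n ∘ₗ Coalgebra.counit := by
            ext c
            have k := pairing_rTensor (homComp K D X X X) (N.act X X) (θ.θ X) (N.act X X n)
              (N.act X X n) (by simp) (η.component X X (𝟙 X) ⊗ₜ[K] c)
            rw [← evalRight_eq_pairing, ← (h X X (𝟙 X) c).1] at k
            simpa using k.symm
          rw [LinearMap.rTensor_tmul, LinearMap.rTensor_tmul, W₁.natTrans_apply,
            pairing_cofreeCoaction θ (N.act X X) _ (fun _ _ => rfl), cofreeCoaction_tmul,
            ← LinearMap.rTensor_comp_apply, e, LinearMap.rTensor_comp_apply,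
            Coalgebra.rTensor_counit_comul]
          simp
      right_triangle := by
        ext M : 2
        apply RightModule.hom_ext
        intro X m
        change pairing (M.toModule.act X X) (θ.θ X) ((M.ρ X).rTensor C
          ((M.toModule.act X X m).rTensor C (η.component X X (𝟙 X)))) = m
        have e : M.ρ X ∘ₗ M.toModule.act X X m =
            (tensorModule E M.toModule).act X X (M.ρ X m) := by
          ext f
          exact M.compat X X f m
        have k : ∀ u, pairing (M.toModule.act X X) (θ.θ X)
            (((tensorModule E M.toModule).act X X u).rTensor C (η.component X X (𝟙 X))) =
            tensorCounit K C (M.toModule.fiber X) u := by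
          intro u
          induction u using TensorProduct.induction_on with
          | zero => simp
          | add s t hs ht => simp only [map_add, LinearMap.rTensor_add, LinearMap.add_apply, hs, ht]
          | tmul p d =>
            rw [pairing_rTensor_evalTwisted (E := E) (θ.θ X) (M.toModule.act X X)
              (M.toModule.act X X) (M.toModule.act X X) (by simp)
              ((tensorModule E M.toModule).act X X) (fun _ _ => rfl), ← (h X X (𝟙 X) d).2]
            simp
        rw [← LinearMap.rTensor_comp_apply, e, k, (M.isRightCoaction X).tensorCounit_apply] }

end Entwined

theorem theorem3p17 {K : Type u} [Field K] {D : Type v} [Category.{u} D] [Preadditive D]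
    [Linear K D] {C : Type u} [AddCommGroup C] [Module K C] [Coalgebra K C]
    (E : Entwined.Entwining K D C) :
    Entwined.IsFrobeniusPair (Entwined.forgetful E) (Entwined.cofree E) ↔
      ∃ (θ : Entwined.V₁ E) (η : Entwined.W₁ E), ∀ (X Y : D) (f : X ⟶ Y) (d : C),
        Coalgebra.counit (R := K) d • f = Entwined.evalRight (θ.θ X) Y d (η.component X Y f) ∧
        Coalgebra.counit (R := K) d • f = Entwined.evalTwisted E (θ.θ X) Y d (η.component X Y f) := by
  constructor
  · rintro ⟨-, ⟨adj⟩⟩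
    exact ⟨_, _, Entwined.isFrobeniusSystem_ofNatTrans adj⟩
  · rintro ⟨θ, η, h⟩
    exact ⟨⟨Entwined.forgetfulAdjunction E⟩,
      ⟨Entwined.IsFrobeniusSystem.adjunction (θ := θ) (η := η) h⟩⟩
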